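/- Let $k,m,n$ be positive integers with $k-1\geqslant m(n-1)$, and let $F$ be a field whose characteristic is either $0$ or greater than $\max\{mn,\,(k-1-m(n-1))n\}$. Let $c_1,\dots,c_n\in F$ be distinct, and let $A_1,\dots,A_n,B_1,\dots,B_n$ be subsets of $F$ with $|A_1|=\cdots=|A_n|=k$ and $|B_1|=\cdots=|B_n|=n$. For all $1\leqslant i<j\leqslant n$ let $S_{ij}\subseteq F$ with $|S_{ij}|<2m$. Then there is a system of distinct representatives $(b_i)_{i=1}^n$ of $(B_i)_{i=1}^n$ (that is, $b_1\in B_1,\dots,b_n\in B_n$ with $b_1,\dots,b_n$ distinct) such that the restricted sumset $$\{a_1+\cdots+a_n:\ a_i\in A_i\text{ for }1\leqslant i\leqslant n,\text{ and } a_i-a_j\notin S_{ij}\text{ and } a_ib_ic_i\neq a_jb_jc_j\text{ whenever }1\leqslant i<j\leqslant n\}$$ has at least $(k-1-m(n-1))n+1$ elements. -/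

import Mathlib

/-- `b` is a system of distinct representatives (SDR) of the finite sequence of sets `B`. -/
def IsSDR {F : Type*} {n : ℕ} (B : Fin n → Finset F) (b : Fin n → F) : Prop :=
  (∀ i, b i ∈ B i) ∧ Function.Injective b

/-- The restricted sumset of all `a₁ + ⋯ + aₙ` with `aᵢ ∈ Aᵢ` for every `i`, and
`aᵢ - aⱼ ∉ Sᵢⱼ`, `aᵢ bᵢ cᵢ ≠ aⱼ bⱼ cⱼ` for all `i < j`. -/
def restrictedSumset {F : Type*} [Field F] {n : ℕ} (A : Fin n → Finset F)
    (S : Fin n → Fin n → Finset F) (b c : Fin n → F) : Set F :=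
  {s | ∃ a : Fin n → F, (∀ i, a i ∈ A i) ∧
    (∀ i j, i < j → a i - a j ∉ S i j ∧ a i * b i * c i ≠ a j * b j * c j) ∧
    ∑ i, a i = s}

/-! The combinatorial Nullstellensatz is applied to a product of three factors: translates of `X j -
X i` excluding the differences in `S i j`, translates of `∑ X i` excluding the supposedly few sums,
and the Vandermonde determinant of the `b i * c i * X i`. The coefficient of `∏ X i ^ (k - 1)`
depends only on the top forms. Antisymmetry splits it as a constant times the permanent of the
Vandermonde matrix of the `b i * c i`. A suitable SDR makes the permanent nonzero
(`exists_isSDR_permanent_ne_zero`). At `b i * c i = 1` the constant is a factor of a coefficient of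
`V ^ (2 * m) * (∑ X i) ^ N`, where `V` is the Vandermonde determinant of the variables. That
coefficient is nonzero by the Nullstellensatz used in reverse: some polynomial with this top form
has exactly one nonzero value on `{0, ..., k - 1} ^ n`
(`coeff_vandermonde_pow_mul_sum_pow_ne_zero`). -/

open MvPolynomial in
/-- `f` has degree at most `D`, and its homogeneous component of degree `D` agrees with that
of `g`, which also has degree at most `D`. -/
def MvPolynomial.HasTop {σ R : Type*} [CommSemiring R] (f g : MvPolynomial σ R) (D : ℕ) : Prop :=
  (∀ s : σ →₀ ℕ, D < s.degree → coeff s f = 0 ∧ coeff s g = 0) ∧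
    ∀ s : σ →₀ ℕ, s.degree = D → coeff s f = coeff s g

namespace MvPolynomial

/-! ### Top forms and the Nullstellensatz in both directions. -/

section HasTop

variable {σ R : Type*}

theorem IsHomogeneous.hasTop [CommSemiring R] {f : MvPolynomial σ R} {D : ℕ}
    (hf : f.IsHomogeneous D) : HasTop f f D :=
  ⟨fun _ hs => ⟨hf.coeff_eq_zero hs.ne', hf.coeff_eq_zero hs.ne'⟩, fun _ _ => rfl⟩

theorem HasTop.mul [CommSemiring R] {f g f' g' : MvPolynomial σ R} {D D' : ℕ}
    (h : HasTop f g D) (h' : HasTop f' g' D') : HasTop (f * f') (g * g') (D + D') := by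
  classical
  refine ⟨fun s hs => ?_, fun s hs => ?_⟩
  · rw [coeff_mul, coeff_mul]
    refine ⟨Finset.sum_eq_zero fun x hx => ?_, Finset.sum_eq_zero fun x hx => ?_⟩ <;>
    · have hd : x.1.degree + x.2.degree = s.degree := by
        rw [← Finset.HasAntidiagonal.mem_antidiagonal.1 hx, map_add]
      rcases lt_or_ge D x.1.degree with h1 | h1
      · simp [h.1 _ h1]
      · simp [h'.1 x.2 (by omega)]
  · rw [coeff_mul, coeff_mul]
    refine Finset.sum_congr rfl fun x hx => ?_
    have hd : x.1.degree + x.2.degree = s.degree := by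
      rw [← Finset.HasAntidiagonal.mem_antidiagonal.1 hx, map_add]
    rcases lt_trichotomy D x.1.degree with h1 | h1 | h1
    · simp [h.1 _ h1]
    · rw [h.2 _ h1.symm, h'.2 x.2 (by omega)]
    · simp [h'.1 x.2 (by omega)]

theorem HasTop.one [CommSemiring R] : HasTop (1 : MvPolynomial σ R) 1 0 :=
  (isHomogeneous_one σ R).hasTop

theorem HasTop.prod [CommSemiring R] {ι : Type*} {f g : ι → MvPolynomial σ R} {D : ι → ℕ}
    (s : Finset ι) (h : ∀ i ∈ s, HasTop (f i) (g i) (D i)) :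
    HasTop (∏ i ∈ s, f i) (∏ i ∈ s, g i) (∑ i ∈ s, D i) := by
  classical
  induction s using Finset.induction_on with
  | empty => simpa using HasTop.one
  | insert a s ha ih =>
    rw [Finset.prod_insert ha, Finset.prod_insert ha, Finset.sum_insert ha]
    exact (h a (by simp)).mul (ih fun i hi => h i (by simp [hi]))

theorem IsHomogeneous.hasTop_add_C [CommSemiring R] {f : MvPolynomial σ R}
    (hf : f.IsHomogeneous 1) (a : R) : HasTop (f + C a) f 1 := by
  classical
  have h0 : ∀ s : σ →₀ ℕ, 1 ≤ s.degree → coeff s (C a : MvPolynomial σ R) = 0 := by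
    intro s hs
    rw [coeff_C, if_neg]
    rintro rfl
    simp at hs
  refine ⟨fun s hs => ?_, fun s hs => ?_⟩
  · rw [coeff_add, hf.coeff_eq_zero hs.ne', h0 s hs.le]
    simp
  · rw [coeff_add, h0 s hs.ge, add_zero]

/-- A product of translates of a linear form `f`, padded with copies of `f`. -/
theorem IsHomogeneous.hasTop_prod_add_C [CommSemiring R] {ι : Type*} {f : MvPolynomial σ R}
    (hf : f.IsHomogeneous 1) (s : Finset ι) (a : ι → R) {d : ℕ} (hd : s.card ≤ d) :
    HasTop ((∏ i ∈ s, (f + C (a i))) * f ^ (d - s.card)) (f ^ d) d := by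
  have h1 := HasTop.prod s fun i _ => hf.hasTop_add_C (a i)
  have h2 := h1.mul (hf.pow (d - s.card)).hasTop
  simp only [Finset.prod_const, Finset.sum_const, smul_eq_mul, mul_one, one_mul] at h2
  rwa [← pow_add, Nat.add_sub_cancel' hd] at h2

/-- The combinatorial Nullstellensatz, with the coefficient read off from the top component. -/
theorem HasTop.exists_eval_ne_zero [CommRing R] [IsDomain R] [Finite σ]
    {f g : MvPolynomial σ R} {D : ℕ}
    (h : HasTop f g D) {t : σ →₀ ℕ} (htD : t.degree = D) (ht : coeff t g ≠ 0)
    (A : σ → Finset R) (hA : ∀ i, t i < (A i).card) :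
    ∃ x : σ → R, (∀ i, x i ∈ A i) ∧ eval x f ≠ 0 := by
  have hf : coeff t f ≠ 0 := by rwa [h.2 t htD]
  refine combinatorial_nullstellensatz_exists_eval_nonzero f t hf (le_antisymm ?_ ?_) A hA
  · refine Finset.sup_le fun s hs => ?_
    by_contra hlt
    exact mem_support_iff.1 hs (h.1 s (by rw [htD] at hlt; exact not_le.1 hlt)).1
  · exact le_totalDegree (mem_support_iff.2 hf)

/-- If `f` has a single nonzero value on a grid, then its top coefficient does not vanish. -/
theorem HasTop.coeff_ne_zero_of_unique [Field R] [Fintype σ] {f g : MvPolynomial σ R} {D : ℕ}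
    (h : HasTop f g D) {t : σ →₀ ℕ} (htD : t.degree = D)
    (A : σ → Finset R) (hA : ∀ i, (A i).card = t i + 1) (z : σ → R) (hz : ∀ i, z i ∈ A i)
    (hfz : eval z f ≠ 0) (huniq : ∀ x : σ → R, (∀ i, x i ∈ A i) → eval x f ≠ 0 → x = z) :
    coeff t g ≠ 0 := by
  classical
  intro h0
  -- On the grid `ℓ` is supported at `z`, so `f - r ℓ` vanishes there for a suitable `r ≠ 0`. If
  -- `coeff t g` were zero, its coefficient at `t` would be `-r`, contradicting the Nullstellensatz.
  let ℓ : MvPolynomial σ R := ∏ i, ∏ a ∈ (A i).erase (z i), (X i + C (-a))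
  let ℓ' : MvPolynomial σ R := ∏ i, X i ^ t i
  have hcard : ∀ i, ((A i).erase (z i)).card = t i := fun i => by
    rw [Finset.card_erase_of_mem (hz i), hA]; rfl
  have hℓ : HasTop ℓ ℓ' D := by
    have := HasTop.prod (Finset.univ : Finset σ) fun i _ =>
      (isHomogeneous_X R i).hasTop_prod_add_C ((A i).erase (z i)) (fun a => -a) (hcard i).le
    rw [← htD, Finsupp.degree_eq_sum]
    simpa only [hcard, Nat.sub_self, pow_zero, mul_one] using this
  have hℓ't : coeff t ℓ' = 1 := by
    have : ℓ' = monomial t 1 := by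
      rw [monomial_eq, C_1, one_mul, Finsupp.prod_fintype _ _ (by simp)]
    rw [this, coeff_monomial, if_pos rfl]
  have hℓz : eval z ℓ ≠ 0 := by
    simp only [ℓ, map_prod, eval_add, eval_X, eval_C, Finset.prod_ne_zero_iff,
      Finset.mem_erase]
    rintro i - a ⟨ha, -⟩
    rw [← sub_eq_add_neg]
    exact sub_ne_zero.2 (Ne.symm ha)
  have hℓx : ∀ x : σ → R, (∀ i, x i ∈ A i) → x ≠ z → eval x ℓ = 0 := by
    intro x hx hxz
    obtain ⟨i, hi⟩ := Function.ne_iff.1 hxz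
    simp only [ℓ, map_prod, eval_add, eval_X, eval_C]
    exact Finset.prod_eq_zero (Finset.mem_univ i)
      (Finset.prod_eq_zero (Finset.mem_erase.2 ⟨hi, hx i⟩) (add_neg_cancel _))
  let r := eval z f / eval z ℓ
  have hr : r ≠ 0 := div_ne_zero hfz hℓz
  have htop : HasTop (f - C r * ℓ) (g - C r * ℓ') D := by
    refine ⟨fun s hs => ?_, fun s hs => ?_⟩
    · simp [h.1 s hs, hℓ.1 s hs]
    · simp [h.2 s hs, hℓ.2 s hs]
  obtain ⟨x, hx, hne⟩ := htop.exists_eval_ne_zero htD (by simp [h0, hℓ't, hr]) A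
    (fun i => by rw [hA]; omega)
  apply hne
  by_cases hxz : x = z
  · subst hxz
    simp [r, div_mul_cancel₀ _ hℓz]
  · have : eval x f = 0 := by
      by_contra hne'
      exact hxz (huniq x hx hne')
    simp [this, hℓx x hx hxz]

end HasTop

end MvPolynomial

/-! ### Antisymmetry: from determinant to permanent. -/

namespace MvPolynomial

section Vandermonde

variable {F : Type*} [CommRing F] {n : ℕ}

/-- A permutation of `Fin n`, viewed as an exponent vector. -/
noncomputable def permExponent (σ : Equiv.Perm (Fin n)) : Fin n →₀ ℕ :=
  Finsupp.equivFunOnFinite.symm fun i => (σ i : ℕ)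

@[simp] theorem permExponent_apply (σ : Equiv.Perm (Fin n)) (i : Fin n) :
    permExponent σ i = σ i := rfl

theorem permExponent_injective :
    Function.Injective (permExponent : Equiv.Perm (Fin n) → Fin n →₀ ℕ) := by
  intro σ τ h
  ext i
  simpa using DFunLike.congr_fun h i

/-- The constant exponent vector. -/
noncomputable def constExponent (n K : ℕ) : Fin n →₀ ℕ :=
  Finsupp.equivFunOnFinite.symm fun _ => K

@[simp] theorem constExponent_apply (K : ℕ) (i : Fin n) : constExponent n K i = K := rfl

theorem degree_constExponent (n K : ℕ) : (constExponent n K).degree = n * K := by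
  simp [Finsupp.degree_eq_sum]

theorem two_mul_degree_permExponent (σ : Equiv.Perm (Fin n)) :
    2 * (permExponent σ).degree = n * (n - 1) := by
  rw [Finsupp.degree_eq_sum]
  simp only [permExponent_apply]
  rw [Equiv.sum_comp σ (fun i : Fin n => (i : ℕ)), Fin.sum_univ_eq_sum_range (fun i => i),
    mul_comm, Finset.sum_range_id_mul_two]

theorem det_vandermonde_C_mul_X (y : Fin n → F) :
    (Matrix.vandermonde fun i => (C (y i) * X i : MvPolynomial (Fin n) F)).det =
      ∑ σ : Equiv.Perm (Fin n),
        monomial (permExponent σ) (((Equiv.Perm.sign σ : ℤ) : F) * ∏ i, y i ^ (σ i : ℕ)) := by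
  rw [← Matrix.det_transpose, Matrix.det_apply']
  refine Finset.sum_congr rfl fun σ _ => ?_
  rw [monomial_eq, Finsupp.prod_fintype _ _ (by simp)]
  simp [Matrix.vandermonde_apply, mul_pow, Finset.prod_mul_distrib, mul_assoc]

theorem det_vandermonde_eq_sum (y : Fin n → F) :
    (Matrix.vandermonde y).det =
      ∑ σ : Equiv.Perm (Fin n), ((Equiv.Perm.sign σ : ℤ) : F) * ∏ i, y i ^ (σ i : ℕ) := by
  rw [← Matrix.det_transpose, Matrix.det_apply']
  simp [Matrix.vandermonde_apply]

theorem coeff_permExponent_det_vandermonde_X (τ : Equiv.Perm (Fin n)) :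
    coeff (permExponent τ) (Matrix.vandermonde (X : Fin n → MvPolynomial (Fin n) F)).det =
      ((Equiv.Perm.sign τ : ℤ) : F) := by
  have h := det_vandermonde_C_mul_X (fun _ : Fin n => (1 : F))
  simp only [C_1, one_mul, one_pow, Finset.prod_const_one, mul_one] at h
  change coeff _ (Matrix.vandermonde fun i => (X i : MvPolynomial (Fin n) F)).det = _
  simp [h, coeff_sum, coeff_monomial, permExponent_injective.eq_iff]

theorem isHomogeneous_det_vandermonde (y : Fin n → F) :
    (Matrix.vandermonde fun i => (C (y i) * X i : MvPolynomial (Fin n) F)).det.IsHomogeneous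
      (permExponent (1 : Equiv.Perm (Fin n))).degree := by
  rw [det_vandermonde_C_mul_X]
  refine IsHomogeneous.sum _ _ _ fun σ _ => isHomogeneous_monomial _ ?_
  have h1 := two_mul_degree_permExponent σ
  have h2 := two_mul_degree_permExponent (1 : Equiv.Perm (Fin n))
  omega

theorem rename_det_vandermonde_X (σ : Equiv.Perm (Fin n)) :
    rename σ (Matrix.vandermonde (X : Fin n → MvPolynomial (Fin n) F)).det =
      (Equiv.Perm.sign σ : ℤ) * (Matrix.vandermonde (X : Fin n → MvPolynomial (Fin n) F)).det := by
  rw [← Matrix.det_permute, AlgHom.map_det]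
  congr 1
  ext1 i j
  simp [Matrix.vandermonde_apply]

/-- The coefficient is a multiple, independent of `y`, of the permanent of the Vandermonde matrix
of `y`. -/
theorem coeff_vandermonde_pow_mul_vandermonde (y : Fin n → F) (m K N : ℕ) (hK : n - 1 ≤ K) :
    coeff (constExponent n K)
      ((Matrix.vandermonde (X : Fin n → MvPolynomial (Fin n) F)).det ^ (2 * m + 1) *
        (∑ i, X i) ^ N *
        (Matrix.vandermonde fun i => (C (y i) * X i : MvPolynomial (Fin n) F)).det) =
    coeff (constExponent n K - permExponent 1)
      ((Matrix.vandermonde (X : Fin n → MvPolynomial (Fin n) F)).det ^ (2 * m + 1) *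
        (∑ i, X i) ^ N) * ∑ σ : Equiv.Perm (Fin n), ∏ i, y i ^ (σ i : ℕ) := by
  set G := (Matrix.vandermonde (X : Fin n → MvPolynomial (Fin n) F)).det ^ (2 * m + 1) *
        (∑ i, X i) ^ N with hG
  have hle : ∀ σ : Equiv.Perm (Fin n), permExponent σ ≤ constExponent n K := by
    intro σ i
    have := (σ i).isLt
    simp only [permExponent_apply, constExponent_apply]
    omega
  -- `G` is antisymmetric because the exponent `2 * m + 1` is odd. The resulting sign cancels the
  -- one in the determinant, which leaves a permanent.
  have hren : ∀ σ : Equiv.Perm (Fin n), rename σ G = (Equiv.Perm.sign σ : ℤ) * G := by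
    intro σ
    rw [hG, map_mul, map_pow, map_pow, rename_det_vandermonde_X, map_sum, mul_pow]
    simp only [rename_X]
    rw [Equiv.sum_comp σ (fun i => (X i : MvPolynomial (Fin n) F)), mul_assoc]
    congr 1
    rcases Int.units_eq_one_or (Equiv.Perm.sign σ) with h | h <;> simp [h, pow_succ, pow_mul]
  have hcoeff : ∀ σ : Equiv.Perm (Fin n), coeff (constExponent n K - permExponent σ) G =
      ((Equiv.Perm.sign σ : ℤ) : F) * coeff (constExponent n K - permExponent 1) G := by
    intro σ
    have hd : (constExponent n K - permExponent σ) =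
        (constExponent n K - permExponent 1).mapDomain (σ⁻¹ : Equiv.Perm (Fin n)) := by
      ext i
      have := Finsupp.mapDomain_apply (σ⁻¹ : Equiv.Perm (Fin n)).injective
        (constExponent n K - permExponent 1) (σ i)
      rw [show (σ⁻¹ : Equiv.Perm (Fin n)) (σ i) = i from σ.symm_apply_apply i] at this
      rw [this]
      simp
    have h1 := coeff_rename_mapDomain (σ⁻¹ : Equiv.Perm (Fin n)) (Equiv.injective _) G
      (constExponent n K - permExponent 1)
    rw [← hd, hren, Equiv.Perm.sign_inv] at h1
    rw [← h1]
    rcases Int.units_eq_one_or (Equiv.Perm.sign σ) with h | h <;> simp [h]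
  rw [det_vandermonde_C_mul_X, Finset.mul_sum, coeff_sum, Finset.mul_sum]
  refine Finset.sum_congr rfl fun σ _ => ?_
  rw [coeff_mul_monomial', if_pos (hle σ), hcoeff]
  rcases Int.units_eq_one_or (Equiv.Perm.sign σ) with h | h <;> simp [h]

end Vandermonde

end MvPolynomial

/-! ### Choice of the representatives. -/

open MvPolynomial in
/-- Every sequence of `n` sets of size `n` has a system of distinct representatives `b` for which
the Vandermonde matrix of `b i * c i` has nonzero permanent. -/
theorem exists_isSDR_permanent_ne_zero {F : Type*} [Field F] {n : ℕ} (c : Fin n → F)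
    (hc : Function.Injective c) (B : Fin n → Finset F) (hB : ∀ i, (B i).card = n) :
    ∃ b : Fin n → F, IsSDR B b ∧
      ∑ σ : Equiv.Perm (Fin n), ∏ i, (b i * c i) ^ (σ i : ℕ) ≠ 0 := by
  let V : MvPolynomial (Fin n) F := (Matrix.vandermonde X).det
  let P : MvPolynomial (Fin n) F :=
    ∑ σ : Equiv.Perm (Fin n), monomial (permExponent σ) (∏ i, c i ^ (σ i : ℕ))
  have hV : V.IsHomogeneous (permExponent (1 : Equiv.Perm (Fin n))).degree := by
    simpa [V] using isHomogeneous_det_vandermonde (fun _ : Fin n => (1 : F))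
  have hP : P.IsHomogeneous (permExponent (1 : Equiv.Perm (Fin n))).degree := by
    refine IsHomogeneous.sum _ _ _ fun σ _ => isHomogeneous_monomial _ ?_
    have h1 := two_mul_degree_permExponent σ
    have h2 := two_mul_degree_permExponent (1 : Equiv.Perm (Fin n))
    omega
  have hdeg : (constExponent n (n - 1)).degree =
      (permExponent (1 : Equiv.Perm (Fin n))).degree +
        (permExponent (1 : Equiv.Perm (Fin n))).degree := by
    rw [degree_constExponent, ← two_mul, two_mul_degree_permExponent]
  -- Each term of the permanent `P` pairs with the term of `V` for the reversed permutation, whose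
  -- sign turns the permanent in `c` into a determinant. Nonvanishing of `V` at `b` will give
  -- distinctness, that of `P` the permanent.
  have hcoeff : coeff (constExponent n (n - 1)) (V * P) =
      ((Equiv.Perm.sign (Fin.revPerm : Equiv.Perm (Fin n)) : ℤ) : F) *
        (Matrix.vandermonde c).det := by
    rw [Finset.mul_sum, coeff_sum, det_vandermonde_eq_sum, Finset.mul_sum]
    refine Finset.sum_congr rfl fun σ _ => ?_
    have hle : permExponent σ ≤ constExponent n (n - 1) := by
      intro i
      have := (σ i).isLt
      simp only [permExponent_apply, constExponent_apply]
      omega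
    have hsub : constExponent n (n - 1) - permExponent σ = permExponent (Fin.revPerm * σ) := by
      ext i
      have := (σ i).isLt
      simp [Fin.val_rev]
      omega
    rw [coeff_mul_monomial', if_pos hle, hsub, coeff_permExponent_det_vandermonde_X,
      Equiv.Perm.sign_mul]
    push_cast
    ring
  have hne : coeff (constExponent n (n - 1)) (V * P) ≠ 0 := by
    rw [hcoeff]
    refine mul_ne_zero ?_ (Matrix.det_vandermonde_ne_zero_iff.2 hc)
    rcases Int.units_eq_one_or (Equiv.Perm.sign (Fin.revPerm : Equiv.Perm (Fin n))) with h | h <;>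
      simp [h]
  obtain ⟨b, hb, hbne⟩ := (hV.mul hP).hasTop.exists_eval_ne_zero hdeg hne B (by
    intro i
    have := i.isLt
    rw [hB, constExponent_apply]
    omega)
  rw [map_mul] at hbne
  refine ⟨b, ⟨hb, ?_⟩, ?_⟩
  · have h1 : eval b V = (Matrix.vandermonde b).det := by
      rw [RingHom.map_det]
      congr 1
      ext i j
      simp [Matrix.vandermonde_apply]
    rw [← Matrix.det_vandermonde_ne_zero_iff, ← h1]
    exact left_ne_zero_of_mul hbne
  · convert right_ne_zero_of_mul hbne using 1
    rw [map_sum]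
    refine Finset.sum_congr rfl fun σ _ => ?_
    rw [eval_monomial, Finsupp.prod_fintype _ _ (by simp)]
    simp [mul_pow, Finset.prod_mul_distrib, mul_comm]

/-! ### The extremal integer configuration. -/

theorem two_mul_sum_card_Ioi (n : ℕ) :
    2 * ∑ i : Fin n, (Finset.Ioi i).card = n * (n - 1) := by
  have h : ∑ i : Fin n, (Finset.Ioi i).card = ∑ i : Fin n, (i : ℕ) := by
    rw [← Equiv.sum_comp Fin.revPerm]
    refine Finset.sum_congr rfl fun i _ => ?_
    have := i.isLt
    simp [Fin.val_rev]
    omega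
  rw [h, Fin.sum_univ_eq_sum_range (fun i => i), mul_comm, Finset.sum_range_id_mul_two]

theorem strictAnti_perm_fin_apply {n : ℕ} {σ : Equiv.Perm (Fin n)} (hσ : StrictAnti σ)
    (i : Fin n) : σ i = i.rev := by
  have h1 : StrictMono (Fin.rev ∘ σ) := fun p q hpq => Fin.rev_lt_rev.2 (hσ hpq)
  have h2 := Subsingleton.elim
    (h1.orderIsoOfSurjective _ (Fin.rev_surjective.comp σ.surjective)) (OrderIso.refl _)
  rw [← Fin.rev_rev (σ i)]
  exact congrArg Fin.rev (DFunLike.congr_fun h2 i)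

/-- Integers in `[0, K]` with pairwise gaps at least `m`, strictly larger for pairs in increasing
position, and whose sum avoids all but the least possible value, form a decreasing arithmetic
progression. -/
theorem eq_rev_mul_of_gaps {n m K : ℕ} (hm : 0 < m) (hK : m * (n - 1) ≤ K) (a : Fin n → ℕ)
    (ha : ∀ i, a i ≤ K) (hgap : ∀ i j, i < j → a i + m + 1 ≤ a j ∨ a j + m ≤ a i)
    (hsum : ∀ t < (K - m * (n - 1)) * n, ∑ i, a i ≠ (∑ i : Fin n, (i : ℕ) * m) + 1 + t)
    (i : Fin n) : a i = (i.rev : ℕ) * m := by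
  obtain _ | n := n
  · exact i.elim0
  simp only [Nat.add_sub_cancel] at hK hsum
  set σ := Tuple.sort a with hσ
  set b := a ∘ σ with hb
  have hmono : Monotone b := Tuple.monotone_sort a
  have hstep : ∀ p q, p < q → b p + m ≤ b q := by
    intro p q hpq
    have h1 : b p ≤ b q := hmono hpq.le
    simp only [hb, Function.comp_apply] at h1 ⊢
    rcases lt_or_gt_of_ne (σ.injective.ne hpq.ne) with h | h
    · rcases hgap _ _ h with h' | h' <;> omega
    · rcases hgap _ _ h with h' | h' <;> omega
  have hdist : ∀ d (p q : Fin (n + 1)), (q : ℕ) = p + d → b p + d * m ≤ b q := by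
    intro d
    induction d with
    | zero => intro p q h; simp [Fin.ext (h.trans (add_zero _))]
    | succ d ih =>
      intro p q h
      have hq := q.isLt
      have h1 := ih p ⟨p + d, by omega⟩ rfl
      have h2 := hstep ⟨p + d, by omega⟩ q (by rw [Fin.lt_def]; simp; omega)
      rw [add_mul, one_mul]
      omega
  have hlow : ∀ i : Fin (n + 1), (i : ℕ) * m ≤ b i := fun i => by
    have := hdist i 0 i (by simp)
    omega
  have hupp : ∀ i : Fin (n + 1), b i + (i.rev : ℕ) * m ≤ K := fun i => by
    have h1 := hdist i.rev i (Fin.last n) (by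
      have := i.isLt
      simp [Fin.val_rev]
      omega)
    exact h1.trans (ha _)
  have hsab : ∑ i, b i = ∑ i, a i := Equiv.sum_comp σ a
  have hs1 : ∑ i : Fin (n + 1), (i : ℕ) * m ≤ ∑ i, b i := Finset.sum_le_sum fun i _ => hlow i
  have hs2 : ∑ i, b i + ∑ i : Fin (n + 1), (i : ℕ) * m ≤ (n + 1) * K := by
    rw [← Equiv.sum_comp Fin.revPerm (fun i : Fin (n + 1) => (i : ℕ) * m),
      ← Finset.sum_add_distrib]
    refine (Finset.sum_le_sum fun i _ => hupp i).trans ?_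
    simp
  have hs3 : 2 * ∑ i : Fin (n + 1), (i : ℕ) * m = (n + 1) * (m * n) := by
    rw [← Finset.sum_mul, Fin.sum_univ_eq_sum_range (fun i => i), ← mul_assoc, mul_comm 2,
      Finset.sum_range_id_mul_two]
    simp only [Nat.add_sub_cancel]
    ring
  have hN : (K - m * n) * (n + 1) + (n + 1) * (m * n) = (n + 1) * K := by
    rw [mul_comm, ← mul_add, Nat.sub_add_cancel hK]
  -- With `μ` the left side, the gaps confine the sum to `[μ, μ + N]`, where `N = (K - m * n) * (n +
  -- 1)`; `hsum` excludes everything but `μ`.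
  have hs4 : ∑ i : Fin (n + 1), (i : ℕ) * m = ∑ i, b i := by
    by_contra hne
    refine hsum (∑ i, a i - ∑ i : Fin (n + 1), (i : ℕ) * m - 1) ?_ ?_ <;> omega
  have heq : ∀ i : Fin (n + 1), (i : ℕ) * m = b i := fun i =>
    (Finset.sum_eq_sum_iff_of_le fun i _ => hlow i).1 hs4 i (Finset.mem_univ i)
  -- Consecutive sorted values differ by exactly `m`, which is allowed only when the larger value
  -- stands at the earlier position.
  have hanti : StrictAnti σ := by
    rw [Fin.strictAnti_iff_succ_lt]
    intro i
    refine lt_of_le_of_ne (not_lt.1 fun hlt => ?_) (σ.injective.ne i.castSucc_lt_succ.ne')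
    have h1 := heq i.castSucc
    have h2 := heq i.succ
    simp only [hb, Function.comp_apply, Fin.val_castSucc, Fin.val_succ, add_mul, one_mul]
      at h1 h2
    rcases hgap _ _ hlt with h' | h' <;> omega
  have h1 := heq i.rev
  simp only [hb, Function.comp_apply] at h1
  rw [h1, strictAnti_perm_fin_apply hanti, Fin.rev_rev]

theorem natCast_ne_zero_of_lt_ringChar {R : Type*} [NonAssocSemiring R] {M a : ℕ}
    (hR : ringChar R = 0 ∨ M < ringChar R) (ha : 0 < a) (haM : a ≤ M) : (a : R) ≠ 0 := by
  intro h
  have hdvd := (ringChar.spec R a).1 h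
  rcases hR with h0 | h0
  · rw [h0, zero_dvd_iff] at hdvd
    omega
  · have := Nat.le_of_dvd ha hdvd
    omega

/-! ### Nonvanishing of the constant. -/

namespace MvPolynomial

variable {F : Type*} {n : ℕ}

theorem isHomogeneous_X_sub_X [CommRing F] (i j : Fin n) :
    (X j - X i : MvPolynomial (Fin n) F).IsHomogeneous 1 :=
  (isHomogeneous_X F j).sub (isHomogeneous_X F i)

theorem isHomogeneous_sum_X [CommRing F] :
    (∑ i, X i : MvPolynomial (Fin n) F).IsHomogeneous 1 :=
  IsHomogeneous.sum _ _ _ fun i _ => isHomogeneous_X F i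

theorem det_vandermonde_X_pow [CommRing F] (d : ℕ) :
    (Matrix.vandermonde (X : Fin n → MvPolynomial (Fin n) F)).det ^ d =
      ∏ i, ∏ j ∈ Finset.Ioi i, (X j - X i) ^ d := by
  simp only [Matrix.det_vandermonde, Finset.prod_pow]

/-- The linear factors are translated so that only the decreasing progression `(n - 1) * m, ..., m,
0` survives on the grid `{0, ..., K} ^ n`; then `HasTop.coeff_ne_zero_of_unique` applies. -/
theorem coeff_vandermonde_pow_mul_sum_pow_ne_zero [Field F] {m K : ℕ} (hn : 0 < n) (hm : 0 < m)
    (hK : m * (n - 1) ≤ K)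
    (hchar : ringChar F = 0 ∨ max (m * n) ((K - m * (n - 1)) * n) < ringChar F) :
    coeff (constExponent n K)
      ((Matrix.vandermonde (X : Fin n → MvPolynomial (Fin n) F)).det ^ (2 * m) *
        (∑ i, X i) ^ ((K - m * (n - 1)) * n)) ≠ 0 := by
  classical
  set N := (K - m * (n - 1)) * n with hN
  have hNK : N + m * n * (n - 1) = n * K := by
    obtain ⟨r, rfl⟩ := Nat.exists_eq_add_of_le hK
    rw [hN, Nat.add_sub_cancel_left]
    ring
  -- In positive characteristic `p`, `n * K = N + (n - 1) * (m * n) < p + (n - 1) * p`, so `K < p`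
  -- and `0, ..., K` stay distinct in `F`.
  have hcastK : ∀ q : ℕ, 0 < q → q ≤ K → (q : F) ≠ 0 := by
    refine fun q => natCast_ne_zero_of_lt_ringChar (hchar.imp_right fun h => ?_)
    obtain ⟨h1, h2⟩ := max_lt_iff.1 h
    obtain ⟨l, rfl⟩ : ∃ l, n = l + 1 := ⟨n - 1, by omega⟩
    simp only [Nat.add_sub_cancel] at hNK
    have h3 := Nat.mul_le_mul_right l h1.le
    by_contra hle
    have h4 := Nat.mul_le_mul_left (l + 1) (not_lt.1 hle)
    nlinarith
  have hinj : Set.InjOn (Nat.cast : ℕ → F) (Finset.range (K + 1) : Set ℕ) := by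
    have key : ∀ x y : ℕ, x < y → y ≤ K → (x : F) ≠ y := by
      intro x y hxy hy h
      refine hcastK (y - x) (by omega) (by omega) ?_
      rw [Nat.cast_sub hxy.le, h, sub_self]
    intro x hx y hy h
    simp only [Finset.coe_range, Set.mem_Iio] at hx hy
    rcases lt_trichotomy x y with h' | h' | h'
    · exact (key x y h' (by omega) h).elim
    · exact h'
    · exact (key y x h' (by omega) h.symm).elim
  set μ := ∑ i : Fin n, (i : ℕ) * m with hμ
  -- The window is deliberately asymmetric: it forbids `x j - x i` from `-(m - 1)` to `m`, so a gap
  -- of exactly `m` survives only in decreasing order. The last product forbids the sums `μ + 1,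
  -- ..., μ + N`.
  let f : MvPolynomial (Fin n) F :=
    (∏ i, ∏ j ∈ Finset.Ioi i, ∏ t ∈ Finset.range (2 * m),
      (X j - X i + C (((m - 1 : ℕ) : F) - t))) *
    ∏ t ∈ Finset.range N, (∑ i, X i + C (-((μ + 1 + t : ℕ) : F)))
  have htop : HasTop f ((Matrix.vandermonde (X : Fin n → MvPolynomial (Fin n) F)).det ^ (2 * m) *
        (∑ i, X i) ^ N) (n * K) := by
    have h1 := HasTop.prod (Finset.univ : Finset (Fin n)) fun i _ =>
      HasTop.prod (Finset.Ioi i) fun j _ =>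
        (isHomogeneous_X_sub_X (F := F) i j).hasTop_prod_add_C (Finset.range (2 * m))
          (fun t => ((m - 1 : ℕ) : F) - t) (Finset.card_range _).le
    have h2 := (isHomogeneous_sum_X (F := F) (n := n)).hasTop_prod_add_C (Finset.range N)
      (fun t => -((μ + 1 + t : ℕ) : F)) (Finset.card_range _).le
    have h3 := h1.mul h2
    simp only [Finset.card_range, Nat.sub_self, pow_zero, mul_one] at h3
    have hdeg : ∑ i : Fin n, ∑ _j ∈ Finset.Ioi i, 2 * m + N = n * K := by
      simp only [Finset.sum_const, smul_eq_mul]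
      rw [← Finset.sum_mul, ← hNK, mul_assoc m, ← two_mul_sum_card_Ioi]
      ring
    rw [hdeg] at h3
    rw [det_vandermonde_X_pow]
    exact h3
  let z : Fin n → ℕ := fun i => (i.rev : ℕ) * m
  have hzK : ∀ i, z i ≤ K := fun i => by
    refine le_trans ?_ hK
    rw [mul_comm m]
    refine Nat.mul_le_mul_right m ?_
    have := i.rev.isLt
    omega
  refine htop.coeff_ne_zero_of_unique (degree_constExponent n K)
    (fun _ => (Finset.range (K + 1)).image Nat.cast)
    (fun i => by rw [Finset.card_image_of_injOn hinj]; simp) (fun i => (z i : F))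
    (fun i => Finset.mem_image_of_mem _ (Finset.mem_range.2 (Nat.lt_succ_of_le (hzK i)))) ?_ ?_
  · simp only [f, map_mul, map_prod, map_sum, eval_add, eval_sub, eval_X, eval_C]
    refine mul_ne_zero ?_ ?_
    · simp only [Finset.prod_ne_zero_iff, Finset.mem_Ioi, Finset.mem_range]
      intro i _ j hij t ht h0
      obtain ⟨e, he⟩ : ∃ e : ℕ, (i.rev : ℕ) = j.rev + 1 + e := by
        have h1 := Fin.rev_lt_rev.2 hij
        rw [Fin.lt_def] at h1
        exact ⟨_, (Nat.add_sub_cancel' h1).symm⟩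
      -- At `z` the factor equals `-(e * m + t + 1)`, and `t < 2 * m` bounds its size by `(e + 2) *
      -- m ≤ m * n`: hence the term `m * n` in the characteristic condition.
      have hen : (1 + e) * m ≤ (n - 1) * m :=
        Nat.mul_le_mul_right m (by have := i.rev.isLt; omega)
      have hmn : (n - 1) * m + m = m * n := by
        obtain ⟨l, rfl⟩ : ∃ l, n = l + 1 := ⟨n - 1, by omega⟩
        simp only [Nat.add_sub_cancel]
        ring
      have h2 : z j + (m - 1) + (e * m + t + 1) = z i + t := by
        simp only [z, he, add_mul, one_mul]
        omega
      refine natCast_ne_zero_of_lt_ringChar (a := e * m + t + 1) hchar (by omega)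
        (le_max_of_le_left ?_) ?_
      · rw [add_mul, one_mul] at hen
        omega
      · have h3 : ((z j + (m - 1) + (e * m + t + 1) : ℕ) : F) = ((z i + t : ℕ) : F) := by rw [h2]
        rw [Nat.cast_add, Nat.cast_add (z j), Nat.cast_add (z i)] at h3
        linear_combination h3 - h0
    · simp only [Finset.prod_ne_zero_iff, Finset.mem_range]
      intro t ht h0
      refine natCast_ne_zero_of_lt_ringChar (a := t + 1) hchar (by omega)
        (le_max_of_le_right ht) ?_
      have h1 : ∑ i, (z i : F) = μ := by
        rw [hμ, ← Equiv.sum_comp Fin.revPerm (fun i : Fin n => (i : ℕ) * m), Nat.cast_sum]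
        rfl
      rw [h1] at h0
      push_cast at h0 ⊢
      linear_combination -h0
  · intro x hx hne
    choose a ha hax using fun i => Finset.mem_image.1 (hx i)
    obtain rfl : (fun i => (a i : F)) = x := _root_.funext hax
    simp only [f, map_mul, map_prod, map_sum, eval_add, eval_sub, eval_X, eval_C] at hne
    obtain ⟨h1, h2⟩ := mul_ne_zero_iff.1 hne
    simp only [Finset.prod_ne_zero_iff, Finset.mem_Ioi, Finset.mem_range] at h1 h2
    have hz : ∀ i, a i = z i := by
      refine eq_rev_mul_of_gaps hm hK a (fun i => Nat.le_of_lt_succ (Finset.mem_range.1 (ha i))) ?_ ?_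
      · intro i j hij
        by_contra! hcon
        refine h1 i (Finset.mem_univ i) j hij (a j + (m - 1) - a i) (by omega) ?_
        rw [Nat.cast_sub (show a i ≤ a j + (m - 1) by omega), Nat.cast_add]
        ring
      · intro t ht hs
        apply h2 t ht
        rw [← Nat.cast_sum, hs, add_neg_cancel]
    funext i
    rw [hz i]

end MvPolynomial

/-! ### The main argument. -/

open MvPolynomial in
theorem theorem1p4 {F : Type*} [Field F] (k m n : ℕ) (hk : 0 < k) (hm : 0 < m) (hn : 0 < n)
    (hkmn : m * (n - 1) ≤ k - 1)
    (hchar : ringChar F = 0 ∨ max (m * n) ((k - 1 - m * (n - 1)) * n) < ringChar F)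
    (c : Fin n → F) (hc : Function.Injective c)
    (A B : Fin n → Finset F) (hA : ∀ i, (A i).card = k) (hB : ∀ i, (B i).card = n)
    (S : Fin n → Fin n → Finset F) (hS : ∀ i j, i < j → (S i j).card < 2 * m) :
    ∃ b : Fin n → F, IsSDR B b ∧
      (k - 1 - m * (n - 1)) * n + 1 ≤ (restrictedSumset A S b c).ncard := by
  classical
  obtain ⟨K, rfl⟩ : ∃ K, k = K + 1 := ⟨k - 1, by omega⟩
  simp only [Nat.add_sub_cancel] at *
  obtain ⟨b, hb, hperm⟩ := exists_isSDR_permanent_ne_zero c hc B hB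
  refine ⟨b, hb, ?_⟩
  by_contra hlt
  have hfin : (restrictedSumset A S b c).Finite := by
    refine (((Fintype.piFinset A).image fun a => ∑ i, a i).finite_toSet).subset ?_
    rintro s ⟨a, ha, -, rfl⟩
    exact Finset.mem_coe.2 (Finset.mem_image_of_mem _ (Fintype.mem_piFinset.2 ha))
  set T := hfin.toFinset with hT
  set N := (K - m * (n - 1)) * n with hN
  have hTN : T.card ≤ N := by
    rw [Set.ncard_eq_toFinset_card _ hfin, ← hT] at hlt
    omega
  have hnK : n - 1 ≤ K := (Nat.le_mul_of_pos_left _ hm).trans hkmn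
  -- Each `S i j` has at most `2 * m - 1 = 2 * l + 1` elements; this odd exponent is what the
  -- antisymmetry needs.
  obtain ⟨l, rfl⟩ : ∃ l, m = l + 1 := ⟨m - 1, by omega⟩
  have hS' : ∀ i j, i < j → (S i j).card ≤ 2 * l + 1 := fun i j hij => by
    have := hS i j hij
    omega
  have hNK : N + (l + 1) * n * (n - 1) = n * K := by
    obtain ⟨r, rfl⟩ := Nat.exists_eq_add_of_le hkmn
    rw [hN, Nat.add_sub_cancel_left]
    ring
  have hcoeff : coeff (constExponent n K)
      ((Matrix.vandermonde (X : Fin n → MvPolynomial (Fin n) F)).det ^ (2 * l + 1) *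
        (∑ i, X i) ^ N *
        (Matrix.vandermonde fun i => (C (b i * c i) * X i : MvPolynomial (Fin n) F)).det) ≠ 0 := by
    rw [coeff_vandermonde_pow_mul_vandermonde _ _ _ _ hnK]
    refine mul_ne_zero ?_ hperm
    -- At `y = 1` the last determinant supplies one more copy of `V`, giving exponent `2 * m`. The
    -- constant divides this nonzero coefficient, so `n! ≠ 0` in `F` need not be checked separately.
    have h1 := coeff_vandermonde_pow_mul_vandermonde (fun _ : Fin n => (1 : F)) l K N hnK
    have h2 := coeff_vandermonde_pow_mul_sum_pow_ne_zero (F := F) hn hm hkmn hchar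
    rw [← hN, show 2 * (l + 1) = 2 * l + 1 + 1 by ring, pow_succ, mul_right_comm] at h2
    simp only [C_1, one_mul] at h1
    exact left_ne_zero_of_mul (h1 ▸ h2)
  have h1 := HasTop.prod (Finset.univ : Finset (Fin n)) fun i _ =>
    HasTop.prod (Finset.Ioi i) fun j hj =>
      (isHomogeneous_X_sub_X (F := F) i j).hasTop_prod_add_C (S i j) (fun s => s)
        (hS' i j (Finset.mem_Ioi.1 hj))
  have h2 := (isHomogeneous_sum_X (F := F) (n := n)).hasTop_prod_add_C T (fun s => -s) hTN
  have h3 := (h1.mul h2).mul (isHomogeneous_det_vandermonde fun i => b i * c i).hasTop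
  rw [← det_vandermonde_X_pow] at h3
  obtain ⟨a, haA, hne⟩ := h3.exists_eval_ne_zero (by
    rw [degree_constExponent, ← hNK]
    have h4 := two_mul_degree_permExponent (1 : Equiv.Perm (Fin n))
    have h5 := two_mul_sum_card_Ioi n
    simp only [Finset.sum_const, smul_eq_mul]
    rw [← Finset.sum_mul, mul_assoc, ← h5, Nat.eq_of_mul_eq_mul_left two_pos (h4.trans h5.symm)]
    ring) hcoeff A (fun i => by rw [hA]; simp)
  simp only [map_mul, map_prod, map_sum, map_pow, eval_add, eval_sub, eval_X, eval_C] at hne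
  obtain ⟨⟨h4, h5⟩, h6⟩ := (mul_ne_zero_iff.trans (and_congr_left' mul_ne_zero_iff)).1 hne
  have hinj : Function.Injective fun i => b i * c i * a i := by
    rw [← Matrix.det_vandermonde_ne_zero_iff]
    convert h6 using 1
    rw [RingHom.map_det]
    congr 1
    ext i j
    simp [Matrix.vandermonde_apply]
  -- The nonzero factors make `a` admissible, so its sum lies in `T`; but the factor for `T`
  -- vanishes at such a sum.
  have hmem : ∑ i, a i ∈ T := by
    rw [hT, Set.Finite.mem_toFinset]
    refine ⟨a, haA, fun i j hij => ⟨fun hs => ?_, fun h => ?_⟩, rfl⟩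
    · rw [Finset.prod_ne_zero_iff] at h4
      have h7 := Finset.prod_ne_zero_iff.1 (h4 i (Finset.mem_univ i)) j (Finset.mem_Ioi.2 hij)
      refine Finset.prod_ne_zero_iff.1 (left_ne_zero_of_mul h7) _ hs ?_
      ring
    · refine hij.ne (hinj ?_)
      linear_combination h
  exact Finset.prod_ne_zero_iff.1 (left_ne_zero_of_mul h5) _ hmem (add_neg_cancel _)
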